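/- For a complex square matrix $A\in\mathcal M_r(\mathbb C)$ let $\mathrm{Spec}(A)$ be its set of eigenvalues and $A^H$ its conjugate transpose. For $\lambda\in\mathbb C$ let $q=q(A,\lambda)$ be the smallest positive integer $k$ with $\operatorname{rank}(A-\lambda I_r)^k=\operatorname{rank}(A-\lambda I_r)^{k+1}$, and put $w_k(A,\lambda)=\operatorname{rank}(A-\lambda I_r)^{k-1}-\operatorname{rank}(A-\lambda I_r)^{k}$ for $k\ge 1$ (so $w_1(A,\lambda)=r-\operatorname{rank}(A-\lambda I_r)$). The Weyr characteristic of $A$ associated with $\lambda$ is the tuple $\mathbf w(A,\lambda)=(w_1(A,\lambda),\dots,w_q(A,\lambda))\in\mathbb N^{q}$. (i) Let $A\in\mathcal M_r(\mathbb C)$. The homogeneous Lyapunov equation $A^HX+XA=0$ has an invertible solution $X\in\mathcal M_r(\mathbb C)$ if and only if for every $\lambda\in\mathrm{Spec}(A)$ we have $-\overline{\lambda}\in\mathrm{Spec}(A)$ and $\mathbf w(A,\lambda)=\mathbf w(A,-\overline{\lambda})$. (ii) Let $A=J_{s_1}(\lambda_1)\oplus\cdots\oplus J_{s_k}(\lambda_k)$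 be a Jordan matrix, where $s_1,\dots,s_k\ge 1$, $\lambda_1,\dots,\lambda_k\in\mathbb C$, and $J_s(\lambda)$ is the $s\times s$ Jordan block with $\lambda$ on the diagonal and $1$ on the superdiagonal. The equation $A^HX+XA=0$ has an invertible solution $X$ if and only if for every $\alpha\in\{1,\dots,k\}$ we have $-\overline{\lambda_\alpha}\in\{\lambda_1,\dots,\lambda_k\}$ and $\mathbf w(A,\lambda_\alpha)=\mathbf w(A,-\overline{\lambda_\alpha})$. -/

import Mathlib

open Matrix

namespace Lyapunov

/-- `l` is an eigenvalue of the square complex matrix `A`, i.e. `l ∈ Spec(A)`. -/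
def IsEigenvalue {r : ℕ} (A : Matrix (Fin r) (Fin r) ℂ) (l : ℂ) : Prop :=
  Module.End.HasEigenvalue (Matrix.toLin' A) l

/-- The rank of `(A - l I) ^ k`. For `k = 0` this is `rank I = r`. -/
noncomputable def powRank {r : ℕ} (A : Matrix (Fin r) (Fin r) ℂ) (l : ℂ) (k : ℕ) : ℕ :=
  ((A - l • (1 : Matrix (Fin r) (Fin r) ℂ)) ^ k).rank

/-- The ranks of the successive powers decrease, so the subtraction in `weyrNumber` below
never truncates. -/
theorem powRank_succ_le {r : ℕ} (A : Matrix (Fin r) (Fin r) ℂ) (l : ℂ) (k : ℕ) :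
    powRank A l (k + 1) ≤ powRank A l k := by
  unfold powRank
  rw [pow_succ]
  exact Matrix.rank_mul_le_left _ _

/-- The ranks of the successive powers stabilize, so that `index` below is well defined. -/
theorem exists_powRank_eq {r : ℕ} (A : Matrix (Fin r) (Fin r) ℂ) (l : ℂ) :
    ∃ k : ℕ, 0 < k ∧ powRank A l k = powRank A l (k + 1) := by
  by_contra! h
  have key : ∀ k : ℕ, powRank A l (k + 1) + k ≤ powRank A l 1 := by
    intro k
    induction k with
    | zero => simp
    | succ k ih =>
      have h1 := powRank_succ_le A l (k + 1)
      have h2 := h (k + 1) (Nat.succ_pos k)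
      omega
  have := key (powRank A l 1 + 1)
  omega

open Classical in
/-- The index of `l`: the smallest positive integer `k` such that
`rank (A - l I) ^ k = rank (A - l I) ^ (k + 1)`. -/
noncomputable def index {r : ℕ} (A : Matrix (Fin r) (Fin r) ℂ) (l : ℂ) : ℕ :=
  Nat.find (exists_powRank_eq A l)

/-- The entry `w_k = rank (A - l I) ^ (k - 1) - rank (A - l I) ^ k`, for `k ≥ 1`; in particular
`w_1 = r - rank (A - l I)`. -/
noncomputable def weyrNumber {r : ℕ} (A : Matrix (Fin r) (Fin r) ℂ) (l : ℂ) (k : ℕ) : ℕ :=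
  powRank A l (k - 1) - powRank A l k

/-- The Weyr characteristic of `A` at `l`: the tuple `(w_1, …, w_q)`, with `q` the index of `l`,
as a list (so that equality means equal length and equal entries). -/
noncomputable def weyr {r : ℕ} (A : Matrix (Fin r) (Fin r) ℂ) (l : ℂ) : List ℕ :=
  List.ofFn fun j : Fin (index A l) => weyrNumber A l ((j : ℕ) + 1)

/-- The homogeneous Lyapunov equation `Aᴴ X + X A = 0` has an invertible solution `X`. -/
def HasInvertibleSolution {r : ℕ} (A : Matrix (Fin r) (Fin r) ℂ) : Prop :=
  ∃ X : Matrix (Fin r) (Fin r) ℂ, Aᴴ * X + X * A = 0 ∧ IsUnit X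

/-- The Jordan block of size `r`: `l` on the diagonal, `1` on the superdiagonal. -/
def jordanBlock (r : ℕ) (l : ℂ) : Matrix (Fin r) (Fin r) ℂ :=
  Matrix.of fun i j => if j = i then l else if (j : ℕ) = (i : ℕ) + 1 then 1 else 0

/-- The Jordan matrix with diagonal blocks `jordanBlock (s 0) (l 0)`, `jordanBlock (s 1) (l 1)`, …,
in this order; `finSigmaFinEquiv` numbers the rows of the blocks consecutively. -/
def jordanMatrix {k : ℕ} (s : Fin k → ℕ) (l : Fin k → ℂ) :
    Matrix (Fin (∑ i, s i)) (Fin (∑ i, s i)) ℂ :=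
  Matrix.reindex finSigmaFinEquiv finSigmaFinEquiv
    (Matrix.blockDiagonal' fun i => jordanBlock (s i) (l i))

end Lyapunov

namespace Lyapunov

open Polynomial

section SmulRank

variable (K : Type*) [Field K]

/-- The dimension over `K` of `a • M`, for a `K[X]`-module `M`. -/
noncomputable def smulRank (M : Type*) [AddCommGroup M] [Module K M] [Module K[X] M]
    [IsScalarTower K K[X] M] (a : K[X]) : ℕ :=
  Module.finrank K (LinearMap.range (LinearMap.lsmul K[X] M a))

variable {K}

theorem smulRank_congr {M N : Type*} [AddCommGroup M] [Module K M] [Module K[X] M]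
    [IsScalarTower K K[X] M] [AddCommGroup N] [Module K N] [Module K[X] N]
    [IsScalarTower K K[X] N] (e : M ≃ₗ[K[X]] N) (a : K[X]) :
    smulRank K M a = smulRank K N a := by
  have h : (LinearMap.range (LinearMap.lsmul K[X] M a)).map (e : M →ₗ[K[X]] N) =
      LinearMap.range (LinearMap.lsmul K[X] N a) := by
    ext y
    simp only [Submodule.mem_map, LinearMap.mem_range, LinearMap.lsmul_apply]
    constructor
    · rintro ⟨_, ⟨x, rfl⟩, rfl⟩
      exact ⟨e x, by simp⟩
    · rintro ⟨x, rfl⟩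
      exact ⟨a • e.symm x, ⟨_, rfl⟩, by simp⟩
  unfold smulRank
  rw [← h]
  exact ((e.submoduleMap _).restrictScalars K).finrank_eq

theorem smulRank_pi {ι : Type*} [Fintype ι] (M : ι → Type*) [∀ i, AddCommGroup (M i)]
    [∀ i, Module K (M i)] [∀ i, Module K[X] (M i)] [∀ i, IsScalarTower K K[X] (M i)]
    [∀ i, FiniteDimensional K (M i)] (a : K[X]) :
    smulRank K (∀ i, M i) a = ∑ i, smulRank K (M i) a := by
  have (i : ι) : FiniteDimensional K (LinearMap.range (LinearMap.lsmul K[X] (M i) a)) :=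
    inferInstanceAs (FiniteDimensional K
      ((LinearMap.range (LinearMap.lsmul K[X] (M i) a)).restrictScalars K))
  unfold smulRank
  rw [← Module.finrank_pi_fintype]
  refine LinearEquiv.finrank_eq
    { toFun := fun x i => ⟨x.1 i, ?_⟩
      invFun := fun y => ⟨fun i => (y i).1, ?_⟩
      map_add' := fun _ _ => rfl
      map_smul' := fun _ _ => rfl
      left_inv := fun _ => rfl
      right_inv := fun _ => rfl }
  · obtain ⟨z, hz⟩ := x.2
    exact ⟨z i, by rw [← hz]; rfl⟩
  · choose z hz using fun i => (y i).2
    exact ⟨z, by ext i; exact hz i⟩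

/-- The cyclic `K[X]`-module whose endomorphism `X` is a Jordan block. -/
abbrev CyclicModule (l : K) (e : ℕ) : Type _ := K[X] ⧸ Ideal.span {(X - C l) ^ e}

instance (l : K) (e : ℕ) : FiniteDimensional K (CyclicModule l e) :=
  ((monic_X_sub_C l).pow e).finite_quotient

theorem smulRank_quotient (a b c : K[X]) (h : ∀ x, a ∣ x * b ↔ c ∣ x) :
    smulRank K (K[X] ⧸ Ideal.span {a}) b = c.natDegree := by
  have hrange : LinearMap.range (LinearMap.lsmul K[X] (K[X] ⧸ Ideal.span {a}) b) =
      Submodule.span K[X] {(Ideal.Quotient.mk (Ideal.span {a}) b)} := by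
    ext y
    rw [Submodule.mem_span_singleton, LinearMap.mem_range]
    constructor
    · rintro ⟨x, rfl⟩
      obtain ⟨x, rfl⟩ := Ideal.Quotient.mk_surjective x
      refine ⟨x, ?_⟩
      change Ideal.Quotient.mk _ (x * b) = Ideal.Quotient.mk _ (b * x)
      rw [mul_comm]
    · rintro ⟨x, rfl⟩
      refine ⟨Ideal.Quotient.mk _ x, ?_⟩
      change Ideal.Quotient.mk _ (b * x) = Ideal.Quotient.mk _ (x * b)
      rw [mul_comm]
  have htors : Ideal.torsionOf K[X] (K[X] ⧸ Ideal.span {a})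
      (Ideal.Quotient.mk (Ideal.span {a}) b) = Ideal.span {c} := by
    ext x
    rw [Ideal.mem_torsionOf_iff, Ideal.mem_span_singleton, ← h, ← Ideal.mem_span_singleton,
      ← Ideal.Quotient.eq_zero_iff_mem]
    rfl
  unfold smulRank
  rw [hrange, ← finrank_quotient_span_eq_natDegree, ← htors]
  exact ((Ideal.quotTorsionOfEquivSpanSingleton K[X] _ _).restrictScalars K).finrank_eq.symm

open Classical in
theorem smulRank_cyclicModule (l m : K) (e k : ℕ) :
    smulRank K (CyclicModule l e) ((X - C m) ^ k) = if l = m then e - k else e := by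
  split_ifs with h
  · subst h
    rw [smulRank_quotient _ _ ((X - C l) ^ (e - k))]
    · simp
    · intro x
      have h0 : (X - C l) ^ k ≠ 0 := pow_ne_zero _ (X_sub_C_ne_zero l)
      rcases le_total k e with hk | hk
      · conv_lhs => rw [← Nat.sub_add_cancel hk, pow_add]
        exact mul_dvd_mul_iff_right h0
      · rw [Nat.sub_eq_zero_of_le hk]
        simp only [pow_zero, isUnit_one, IsUnit.dvd, iff_true]
        exact (pow_dvd_pow _ hk).mul_left x
  · rw [smulRank_quotient _ _ ((X - C l) ^ e)]
    · simp
    · intro x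
      have hc : IsCoprime ((X - C l) ^ e) ((X - C m) ^ k) :=
        (isCoprime_X_sub_C_of_isUnit_sub (sub_ne_zero.2 h).isUnit).pow
      exact ⟨hc.dvd_of_dvd_mul_right, fun hx => hx.mul_right _⟩

end SmulRank

section Decomposition

universe u

variable {K : Type u} [Field K]

/-- Discarding the trivial factors of a product. -/
noncomputable def piSubtypeEquiv {R : Type*} [Ring R] {ι : Type*} (M : ι → Type*)
    [∀ i, AddCommGroup (M i)] [∀ i, Module R (M i)] (p : ι → Prop)
    (h : ∀ i, ¬ p i → Subsingleton (M i)) : (∀ i, M i) ≃ₗ[R] ∀ i : {i // p i}, M i := by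
  classical
  refine LinearEquiv.ofBijective (LinearMap.pi fun i => LinearMap.proj i.1) ⟨?_, ?_⟩
  · intro x y hxy
    ext i
    by_cases hi : p i
    · exact congrFun hxy ⟨i, hi⟩
    · exact (h i hi).elim _ _
  · intro y
    refine ⟨fun i => if hi : p i then y ⟨i, hi⟩ else 0, ?_⟩
    ext i
    simp [i.2]

theorem exists_equiv_pi_cyclicModule [IsAlgClosed K] (M : Type*) [AddCommGroup M]
    [Module K[X] M] [Module.Finite K[X] M] (hM : Module.IsTorsion K[X] M) :
    ∃ (ι : Type u) (_ : Fintype ι) (l : ι → K) (e : ι → ℕ), (∀ i, 0 < e i) ∧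
      Nonempty (M ≃ₗ[K[X]] ∀ i, CyclicModule (l i) (e i)) := by
  classical
  obtain ⟨ι, _, p, hp, e, ⟨f⟩⟩ := Module.equiv_directSum_of_isTorsion hM
  have hroot (i : ι) : ∃ l : K, Associated (p i) (X - C l) := by
    obtain ⟨l, hl⟩ := IsAlgClosed.exists_root (p i)
      (by rw [IsAlgClosed.degree_eq_one_of_irreducible K (hp i)]; exact one_ne_zero)
    exact ⟨l, ((irreducible_X_sub_C l).associated_of_dvd (hp i) (dvd_iff_isRoot.2 hl)).symm⟩
  choose l hl using hroot
  have hspan (i : ι) : Ideal.span {p i ^ e i} = Ideal.span {(X - C (l i)) ^ e i} :=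
    Ideal.span_singleton_eq_span_singleton.2 ((hl i).pow_pow)
  refine ⟨{i // 0 < e i}, inferInstance, fun i => l i, fun i => e i, fun i => i.2, ⟨?_⟩⟩
  refine f ≪≫ₗ DirectSum.linearEquivFunOnFintype _ _ _ ≪≫ₗ
    LinearEquiv.piCongrRight (fun i => Submodule.quotEquivOfEq _ _ (hspan i)) ≪≫ₗ
    piSubtypeEquiv (fun i => CyclicModule (l i) (e i)) (fun i => 0 < e i) ?_
  intro i hi
  have : e i = 0 := by omega
  rw [Ideal.Quotient.subsingleton_iff, this]
  simp

open Classical in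
theorem smulRank_second_difference {ι : Type*} [Fintype ι] (l : ι → K) (e : ι → ℕ) (m : K)
    (k : ℕ) :
    smulRank K (∀ i, CyclicModule (l i) (e i)) ((X - C m) ^ k) +
      smulRank K (∀ i, CyclicModule (l i) (e i)) ((X - C m) ^ (k + 2)) =
    2 * smulRank K (∀ i, CyclicModule (l i) (e i)) ((X - C m) ^ (k + 1)) +
      Fintype.card {i // (l i, e i) = (m, k + 1)} := by
  simp only [smulRank_pi, smulRank_cyclicModule, Fintype.card_subtype, Finset.card_filter,
    Finset.mul_sum, ← Finset.sum_add_distrib]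
  refine Finset.sum_congr rfl fun i _ => ?_
  simp only [Prod.mk.injEq]
  by_cases h : l i = m <;> simp only [h, if_true, if_false, true_and, false_and]
  · split_ifs <;> omega
  · omega

/-- Over an algebraically closed field, a finite torsion `K[X]`-module is determined by the
dimensions of its submodules `(X - m) ^ k • M`. -/
theorem nonempty_equiv_of_smulRank_eq [IsAlgClosed K] {M N : Type*} [AddCommGroup M] [Module K M]
    [Module K[X] M] [IsScalarTower K K[X] M] [Module.Finite K[X] M]
    (hM : Module.IsTorsion K[X] M) [AddCommGroup N] [Module K N]
    [Module K[X] N] [IsScalarTower K K[X] N] [Module.Finite K[X] N]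
    (hN : Module.IsTorsion K[X] N)
    (h : ∀ m k, smulRank K M ((X - C m) ^ k) = smulRank K N ((X - C m) ^ k)) :
    Nonempty (M ≃ₗ[K[X]] N) := by
  classical
  obtain ⟨ι, _, l, e, he, ⟨f⟩⟩ := exists_equiv_pi_cyclicModule (K := K) M hM
  obtain ⟨κ, _, l', e', he', ⟨g⟩⟩ := exists_equiv_pi_cyclicModule (K := K) N hN
  have hcard (c : K × ℕ) : Nonempty ({i // (l i, e i) = c} ≃ {j // (l' j, e' j) = c}) := by
    obtain ⟨m, _ | k⟩ := c
    · have h1 : IsEmpty {i // (l i, e i) = (m, 0)} :=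
        ⟨fun i => (he i.1).ne' (congrArg Prod.snd i.2)⟩
      have h2 : IsEmpty {j // (l' j, e' j) = (m, 0)} :=
        ⟨fun i => (he' i.1).ne' (congrArg Prod.snd i.2)⟩
      exact ⟨Equiv.equivOfIsEmpty _ _⟩
    · refine Fintype.card_eq.1 ?_
      have h1 := smulRank_second_difference l e m k
      have h2 := smulRank_second_difference l' e' m k
      simp only [← smulRank_congr f] at h1
      simp only [← smulRank_congr g, ← h] at h2
      omega
  let σ : ι ≃ κ :=
    Equiv.ofFiberEquiv (f := fun i => (l i, e i)) (g := fun j => (l' j, e' j)) fun c => (hcard c).some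
  have hσ (i : ι) : (l' (σ i), e' (σ i)) = (l i, e i) :=
    Equiv.ofFiberEquiv_map (f := fun i => (l i, e i)) (g := fun j => (l' j, e' j)) _ i
  have hspan (i : ι) : Ideal.span {(X - C (l i)) ^ e i} =
      Ideal.span {(X - C (l' (σ i))) ^ e' (σ i)} := by
    obtain ⟨h1, h2⟩ := Prod.mk.inj (hσ i)
    rw [h1, h2]
  exact ⟨f ≪≫ₗ LinearEquiv.piCongrRight (fun i => Submodule.quotEquivOfEq _ _ (hspan i)) ≪≫ₗ
    LinearEquiv.piCongrLeft K[X] (fun j => CyclicModule (l' j) (e' j)) σ ≪≫ₗ g.symm⟩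

end Decomposition

section Similarity

theorem smulRank_aeval {V : Type*} [AddCommGroup V] [Module ℂ V] (f : Module.End ℂ V)
    (p : ℂ[X]) :
    smulRank ℂ (Module.AEval' f) p = Module.finrank ℂ (LinearMap.range (aeval f p)) := by
  have h : ((LinearMap.range (LinearMap.lsmul ℂ[X] (Module.AEval' f) p)).restrictScalars ℂ) =
      (LinearMap.range (aeval f p)).map (Module.AEval'.of f : V →ₗ[ℂ] Module.AEval' f) := by
    ext y
    simp only [Submodule.restrictScalars_mem, LinearMap.mem_range, Submodule.mem_map,
      LinearMap.lsmul_apply]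
    constructor
    · rintro ⟨x, rfl⟩
      exact ⟨_, ⟨(Module.AEval'.of f).symm x, rfl⟩, rfl⟩
    · rintro ⟨_, ⟨x, rfl⟩, rfl⟩
      exact ⟨Module.AEval'.of f x, rfl⟩
  change Module.finrank ℂ ((LinearMap.range
    (LinearMap.lsmul ℂ[X] (Module.AEval' f) p)).restrictScalars ℂ) = _
  rw [h]
  exact LinearEquiv.finrank_map_eq _ _

variable {r : ℕ}

theorem smulRank_toLin' (A : Matrix (Fin r) (Fin r) ℂ) (l : ℂ) (k : ℕ) :
    smulRank ℂ (Module.AEval' (Matrix.toLin' A)) ((X - C l) ^ k) = powRank A l k := by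
  have h : aeval (Matrix.toLin' A) ((X - C l) ^ k) =
      Matrix.toLin' ((A - l • (1 : Matrix (Fin r) (Fin r) ℂ)) ^ k) := by
    rw [Matrix.toLin'_pow, map_sub, map_smul, Matrix.toLin'_one]
    simp [Algebra.algebraMap_eq_smul_one, Module.End.one_eq_id]
  rw [smulRank_aeval, h]
  rfl

/-- Complex matrices with the same ranks of all `(A - l I) ^ k` are similar. -/
theorem exists_isUnit_mul_eq_mul (A B : Matrix (Fin r) (Fin r) ℂ)
    (h : ∀ l k, powRank A l k = powRank B l k) :
    ∃ S : Matrix (Fin r) (Fin r) ℂ, IsUnit S ∧ S * A = B * S := by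
  obtain ⟨e⟩ := nonempty_equiv_of_smulRank_eq (K := ℂ)
    (M := Module.AEval' (Matrix.toLin' A)) (N := Module.AEval' (Matrix.toLin' B))
    (Module.AEval.isTorsion_of_finiteDimensional ℂ _ _)
    (Module.AEval.isTorsion_of_finiteDimensional ℂ _ _)
    (fun m k => by rw [smulRank_toLin', smulRank_toLin', h])
  let g : (Fin r → ℂ) ≃ₗ[ℂ] (Fin r → ℂ) :=
    Module.AEval'.of (Matrix.toLin' A) ≪≫ₗ e.restrictScalars ℂ ≪≫ₗ
      (Module.AEval'.of (Matrix.toLin' B)).symm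
  have hg (v : Fin r → ℂ) : g (Matrix.toLin' A v) = Matrix.toLin' B (g v) := by
    simp only [g, LinearEquiv.trans_apply, LinearEquiv.restrictScalars_apply]
    rw [← Module.AEval'.X_smul_of, map_smul, Module.AEval'.of_symm_X_smul]
  refine ⟨LinearMap.toMatrix' g.toLinearMap, ?_, ?_⟩
  · refine IsUnit.of_mul_eq_one (LinearMap.toMatrix' g.symm.toLinearMap) ?_
    rw [← LinearMap.toMatrix'_comp]
    simp
  · apply Matrix.toLin'.injective
    rw [Matrix.toLin'_mul, Matrix.toLin'_mul, Matrix.toLin'_toMatrix']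
    ext1 v
    ext1
    simp [← hg]

theorem powRank_eq_of_mul_eq_mul {A B S : Matrix (Fin r) (Fin r) ℂ} (hS : IsUnit S)
    (h : S * A = B * S) (l : ℂ) (k : ℕ) : powRank A l k = powRank B l k := by
  have h1 : SemiconjBy S (A - l • (1 : Matrix (Fin r) (Fin r) ℂ)) (B - l • 1) := by
    unfold SemiconjBy
    rw [mul_sub, sub_mul, h]
    simp
  have hdet := (Matrix.isUnit_iff_isUnit_det S).1 hS
  have h2 := congrArg Matrix.rank (h1.pow_right k).eq
  rwa [Matrix.rank_mul_eq_right_of_isUnit_det _ _ hdet,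
    Matrix.rank_mul_eq_left_of_isUnit_det _ _ hdet] at h2

open scoped ComplexOrder in
theorem powRank_neg_conjTranspose (A : Matrix (Fin r) (Fin r) ℂ) (l : ℂ) (k : ℕ) :
    powRank (-Aᴴ) l k = powRank A (-(starRingEnd ℂ) l) k := by
  have h : -Aᴴ - l • (1 : Matrix (Fin r) (Fin r) ℂ) =
      (-1 : Matrix (Fin r) (Fin r) ℂ) * (A - (-(starRingEnd ℂ) l) • 1)ᴴ := by
    simp [Matrix.conjTranspose_smul]
    abel
  have hu : IsUnit ((-1 : Matrix (Fin r) (Fin r) ℂ) ^ k).det :=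
    (Matrix.isUnit_iff_isUnit_det _).1 (isUnit_one.neg.pow k)
  unfold powRank
  rw [h, ((Commute.neg_one_left _).mul_pow k), Matrix.rank_mul_eq_right_of_isUnit_det _ _ hu,
    ← Matrix.conjTranspose_pow, Matrix.rank_conjTranspose]

theorem hasInvertibleSolution_iff_powRank (A : Matrix (Fin r) (Fin r) ℂ) :
    HasInvertibleSolution A ↔ ∀ l k, powRank A l k = powRank A (-(starRingEnd ℂ) l) k := by
  have key (X : Matrix (Fin r) (Fin r) ℂ) : Aᴴ * X + X * A = 0 ↔ X * A = -Aᴴ * X := by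
    rw [neg_mul, add_comm, add_eq_zero_iff_eq_neg]
  simp only [← powRank_neg_conjTranspose]
  constructor
  · rintro ⟨X, hX, hu⟩
    exact powRank_eq_of_mul_eq_mul hu ((key X).1 hX)
  · intro h
    obtain ⟨X, hu, hX⟩ := exists_isUnit_mul_eq_mul A (-Aᴴ) h
    exact ⟨X, (key X).2 hX, hu⟩

end Similarity

section Weyr

variable {r : ℕ} (A : Matrix (Fin r) (Fin r) ℂ)

theorem powRank_zero (l : ℂ) : powRank A l 0 = r := by simp [powRank]

theorem index_spec (l : ℂ) : powRank A l (index A l) = powRank A l (index A l + 1) := by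
  classical
  exact (Nat.find_spec (exists_powRank_eq A l)).2

theorem powRank_add_finrank_ker (l : ℂ) (k : ℕ) :
    powRank A l k + Module.finrank ℂ (LinearMap.ker
      (Matrix.toLin' (A - l • (1 : Matrix (Fin r) (Fin r) ℂ)) ^ k)) = r := by
  rw [← Matrix.toLin'_pow]
  exact (LinearMap.finrank_range_add_finrank_ker
    (Matrix.toLin' ((A - l • (1 : Matrix (Fin r) (Fin r) ℂ)) ^ k))).trans (by simp)

theorem powRank_add_eq (l : ℂ) {k : ℕ} (h : powRank A l k = powRank A l (k + 1)) (m : ℕ) :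
    powRank A l (k + m) = powRank A l k := by
  have h1 := powRank_add_finrank_ker A l k
  have h2 := powRank_add_finrank_ker A l (k + 1)
  have h3 := powRank_add_finrank_ker A l (k + m)
  set f := Matrix.toLin' (A - l • (1 : Matrix (Fin r) (Fin r) ℂ))
  have hle : LinearMap.ker (f ^ k) ≤ LinearMap.ker (f ^ (k + 1)) := by
    rw [pow_succ']
    exact LinearMap.ker_le_ker_comp _ _
  have heq := Submodule.eq_of_le_of_finrank_eq hle (by omega)
  rw [← Module.End.ker_pow_constant heq m] at h3
  omega

theorem powRank_index_add (l : ℂ) (m : ℕ) :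
    powRank A l (index A l + m) = powRank A l (index A l) :=
  powRank_add_eq A l (index_spec A l) m

theorem index_le_of_powRank_eq {l m : ℂ} (h : ∀ k, powRank A l k = powRank A m k) :
    index A l ≤ index A m := by
  classical
  have hm := Nat.find_spec (exists_powRank_eq A m)
  refine Nat.find_min' (exists_powRank_eq A l) ⟨hm.1, ?_⟩
  rw [h, h]
  exact hm.2

theorem length_weyr (l : ℂ) : (weyr A l).length = index A l := List.length_ofFn

theorem getElem?_weyr (l : ℂ) {j : ℕ} (hj : j < index A l) :
    (weyr A l)[j]? = some (weyrNumber A l (j + 1)) := by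
  rw [weyr, List.getElem?_ofFn, dif_pos hj]

theorem powRank_eq_weyrNumber_add (l : ℂ) (k : ℕ) :
    powRank A l k = weyrNumber A l (k + 1) + powRank A l (k + 1) :=
  (Nat.sub_add_cancel (powRank_succ_le A l k)).symm

theorem powRank_eq_of_weyr_eq {l m : ℂ} (h : weyr A l = weyr A m) (k : ℕ) :
    powRank A l k = powRank A m k := by
  have hi : index A l = index A m := by rw [← length_weyr, ← length_weyr, h]
  have hle (k : ℕ) (hk : k ≤ index A l) : powRank A l k = powRank A m k := by
    induction k with
    | zero => rw [powRank_zero, powRank_zero]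
    | succ k ih =>
      have h1 := getElem?_weyr A l (Nat.lt_of_succ_le hk)
      rw [h, getElem?_weyr A m (hi ▸ Nat.lt_of_succ_le hk), Option.some_inj] at h1
      have h2 := ih (Nat.le_of_succ_le hk)
      rw [powRank_eq_weyrNumber_add, powRank_eq_weyrNumber_add A m, h1] at h2
      exact Nat.add_left_cancel h2
  rcases le_total k (index A l) with hk | hk
  · exact hle k hk
  · obtain ⟨n, rfl⟩ := Nat.exists_eq_add_of_le hk
    rw [powRank_index_add, hle _ le_rfl, hi, powRank_index_add]

theorem weyr_eq_of_powRank_eq {l m : ℂ} (h : ∀ k, powRank A l k = powRank A m k) :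
    weyr A l = weyr A m := by
  have hi : index A l = index A m :=
    le_antisymm (index_le_of_powRank_eq A h) (index_le_of_powRank_eq A fun k => (h k).symm)
  refine List.ext_getElem? fun j => ?_
  rcases lt_or_ge j (index A l) with hj | hj
  · rw [getElem?_weyr A l hj, getElem?_weyr A m (hi ▸ hj), weyrNumber, weyrNumber, h, h]
  · rw [List.getElem?_eq_none (by rwa [length_weyr]),
      List.getElem?_eq_none (by rwa [length_weyr, ← hi])]

theorem weyr_eq_iff (l m : ℂ) :
    weyr A l = weyr A m ↔ ∀ k, powRank A l k = powRank A m k :=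
  ⟨powRank_eq_of_weyr_eq A, weyr_eq_of_powRank_eq A⟩

theorem isEigenvalue_iff_powRank_one_ne (l : ℂ) : IsEigenvalue A l ↔ powRank A l 1 ≠ r := by
  have h : Matrix.toLin' (A - l • (1 : Matrix (Fin r) (Fin r) ℂ)) =
      Matrix.toLin' A - algebraMap ℂ (Module.End ℂ (Fin r → ℂ)) l := by
    rw [map_sub, map_smul, Matrix.toLin'_one]
    rfl
  have h1 := powRank_add_finrank_ker A l 1
  rw [pow_one, h] at h1
  rw [IsEigenvalue, Module.End.hasEigenvalue_iff, Module.End.eigenspace_def, ne_eq,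
    ← Submodule.finrank_eq_zero (R := ℂ), ← Algebra.algebraMap_eq_smul_one]
  omega

theorem powRank_eq_of_not_isEigenvalue {l : ℂ} (h : ¬ IsEigenvalue A l) (k : ℕ) :
    powRank A l k = r := by
  rw [isEigenvalue_iff_powRank_one_ne, not_not] at h
  have h0 := powRank_add_eq A l (k := 0) (by rw [powRank_zero, zero_add, h]) k
  rwa [zero_add, powRank_zero] at h0

theorem hasInvertibleSolution_iff :
    HasInvertibleSolution A ↔ ∀ l : ℂ, IsEigenvalue A l →
      IsEigenvalue A (-(starRingEnd ℂ) l) ∧ weyr A l = weyr A (-(starRingEnd ℂ) l) := by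
  rw [hasInvertibleSolution_iff_powRank]
  simp only [weyr_eq_iff]
  constructor
  · intro h l hl
    refine ⟨?_, h l⟩
    rw [isEigenvalue_iff_powRank_one_ne] at hl ⊢
    rwa [← h]
  · intro h l k
    by_cases hl : IsEigenvalue A l
    · exact (h l hl).2 k
    · have hl' : ¬ IsEigenvalue A (-(starRingEnd ℂ) l) := fun h' => hl (by
        simpa using (h _ h').1)
      rw [powRank_eq_of_not_isEigenvalue A hl, powRank_eq_of_not_isEigenvalue A hl']

end Weyr

section Jordan

theorem isUnit_jordanBlock_sub (n : ℕ) {l m : ℂ} (h : l ≠ m) :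
    IsUnit (jordanBlock n l - m • (1 : Matrix (Fin n) (Fin n) ℂ)) := by
  have ht : (jordanBlock n l - m • (1 : Matrix (Fin n) (Fin n) ℂ)).IsUpperTriangular := by
    intro i j hij
    have hij' : (j : ℕ) < i := hij
    have h1 : j ≠ i := ne_of_lt hij
    have h2 : (j : ℕ) ≠ i + 1 := by omega
    simp [jordanBlock, h1, h1.symm, h2]
  rw [Matrix.isUnit_iff_isUnit_det, Matrix.det_of_isUpperTriangular ht]
  simp [jordanBlock, sub_eq_zero, h]

theorem isEigenvalue_jordanMatrix_iff {k : ℕ} (s : Fin k → ℕ) (l : Fin k → ℂ)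
    (hs : ∀ i, 0 < s i) (m : ℂ) : IsEigenvalue (jordanMatrix s l) m ↔ m ∈ Set.range l := by
  constructor
  · intro h
    by_contra hm
    have hu (i : Fin k) : IsUnit (jordanBlock (s i) (l i) - m • (1 : Matrix _ _ ℂ)) :=
      isUnit_jordanBlock_sub _ fun hi => hm ⟨i, hi⟩
    have hB : IsUnit (fun i => jordanBlock (s i) (l i) - m • (1 : Matrix _ _ ℂ)) :=
      Pi.isUnit_iff.2 hu
    have hC := (hB.map (Matrix.blockDiagonal'RingHom (fun i => Fin (s i)) ℂ)).map
      (Matrix.reindexAlgEquiv ℂ ℂ (finSigmaFinEquiv (n := s)))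
    have hD : Matrix.reindexAlgEquiv ℂ ℂ (finSigmaFinEquiv (n := s))
        (Matrix.blockDiagonal'RingHom (fun i => Fin (s i)) ℂ
          (fun i => jordanBlock (s i) (l i) - m • (1 : Matrix _ _ ℂ))) =
        jordanMatrix s l - m • (1 : Matrix _ _ ℂ) := by
      have h1 : (fun i => jordanBlock (s i) (l i) - m • (1 : Matrix _ _ ℂ)) =
          (fun i => jordanBlock (s i) (l i)) - m • (1 : ∀ i, Matrix (Fin (s i)) (Fin (s i)) ℂ) :=
        rfl
      rw [h1, Matrix.blockDiagonal'RingHom_apply, Matrix.blockDiagonal'_sub,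
        Matrix.blockDiagonal'_smul, Matrix.blockDiagonal'_one, map_sub, map_smul, map_one]
      rfl
    rw [hD] at hC
    rw [isEigenvalue_iff_powRank_one_ne, powRank, pow_one] at h
    exact h (by simpa using Matrix.rank_of_isUnit _ hC)
  · rintro ⟨i, rfl⟩
    refine Module.End.hasEigenvalue_of_hasEigenvector
      (x := Pi.single (finSigmaFinEquiv ⟨i, ⟨0, hs i⟩⟩) 1) ?_
    rw [Module.End.hasEigenvector_iff, Module.End.mem_eigenspace_iff]
    refine ⟨?_, by simp⟩
    rw [Matrix.toLin'_apply, Matrix.mulVec_single_one]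
    ext a
    obtain ⟨⟨j, b⟩, rfl⟩ := finSigmaFinEquiv.surjective a
    simp only [jordanMatrix, Matrix.col_apply, Matrix.reindex_apply, Matrix.submatrix_apply,
      Equiv.symm_apply_apply, Pi.smul_apply, smul_eq_mul]
    by_cases hj : j = i
    · subst hj
      rw [Matrix.blockDiagonal'_apply_eq]
      by_cases hb : b = ⟨0, hs j⟩
      · subst hb
        simp [jordanBlock]
      · simp [jordanBlock, hb, Ne.symm hb]
    · rw [Matrix.blockDiagonal'_apply_ne _ _ _ hj]
      simp [hj]

end Jordan

end Lyapunov

theorem mainTheorem2 :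
    (∀ (r : ℕ) (A : Matrix (Fin r) (Fin r) ℂ),
      Lyapunov.HasInvertibleSolution A ↔
        ∀ l : ℂ, Lyapunov.IsEigenvalue A l →
          Lyapunov.IsEigenvalue A (-(starRingEnd ℂ) l) ∧
            Lyapunov.weyr A l = Lyapunov.weyr A (-(starRingEnd ℂ) l)) ∧
    (∀ (k : ℕ) (s : Fin k → ℕ) (l : Fin k → ℂ), (∀ i, 0 < s i) →
      (Lyapunov.HasInvertibleSolution (Lyapunov.jordanMatrix s l) ↔
        ∀ a : Fin k, -(starRingEnd ℂ) (l a) ∈ Set.range l ∧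
          Lyapunov.weyr (Lyapunov.jordanMatrix s l) (l a) =
            Lyapunov.weyr (Lyapunov.jordanMatrix s l) (-(starRingEnd ℂ) (l a)))) := by
  refine ⟨fun r A => Lyapunov.hasInvertibleSolution_iff A, fun k s l hs => ?_⟩
  rw [Lyapunov.hasInvertibleSolution_iff]
  simp only [Lyapunov.isEigenvalue_jordanMatrix_iff s l hs, Set.forall_mem_range]
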